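/- Let $\mathcal X,\mathcal Y,\mathcal A,\mathcal B$ be finite sets, $A=|\mathcal A|$, $B=|\mathcal B|$. A family $\mathbf p=(p(a,b|x,y))$ of real numbers, indexed by $x\in\mathcal X$, $y\in\mathcal Y$, $a\in\mathcal A$, $b\in\mathcal B$, is a *non-signaling distribution* if $p(\cdot,\cdot|x,y)$ is a probability distribution on $\mathcal A\times\mathcal B$ for all $x,y$, the marginal $\sum_b p(a,b|x,y)$ does not depend on $y$, and the marginal $\sum_a p(a,b|x,y)$ does not depend on $x$. It is *local* if it is a convex combination of distributions of the form $p(a,b|x,y)=\delta_{a=f(x)}\,\delta_{b=g(y)}$ with $f:\mathcal X\to\mathcal A$, $g:\mathcal Y\to\mathcal B$. It is *quantum* if there are a complex Hilbert space $H$ (of any dimension), a unit vector $\psi\in H$ and bounded self-adjoint operators $E_a(x)$, $F_b(y)$ on $H$ with $E_a(x)E_{a'}(x)=\delta_{aa'}E_a(x)$, $F_b(y)F_{b'}(y)=\delta_{bb'}F_b(y)$, $\sum_aE_a(x)=\sum_bF_b(y)=\mathbb 1$ and $E_a(x)F_b(y)=F_b(y)E_a(x)$, such that $p(a,b|x,y)=\langle\psi,E_a(x)F_b(y)\psi\rangle$.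 Let $\mathcal L$ and $\mathcal Q$ be the sets of local and of quantum distributions, and put $$\tilde\nu(\mathbf p)=\inf\Big\{\sum_i|q_i| : \mathbf p=\sum_i q_i\mathbf p_i,\ q_i\in\mathbb R,\ \mathbf p_i\in\mathcal L\Big\},\qquad \tilde\gamma_2(\mathbf p)=\inf\Big\{\sum_i|q_i| : \mathbf p=\sum_i q_i\mathbf p_i,\ q_i\in\mathbb R,\ \mathbf p_i\in\mathcal Q\Big\},$$ over finite sums. Let $K_G$ be the (real) Grothendieck constant, that is, the least $K$ such that for all real matrices $M=(M_{ij})$ with $\big|\sum_{i,j}M_{ij}s_it_j\big|\le1$ for all $s_i,t_j\in\{\pm1\}$, and all unit vectors $u_i,v_j$ in a Euclidean space $\mathbb R^d$, one has $\big|\sum_{i,j}M_{ij}\langle u_i,v_j\rangle\big|\le K$. **Theorem.** For every non-signaling distribution $\mathbf p$ with inputs in $\mathcal X\times\mathcal Y$ and outcomes in $\mathcal A\times\mathcal B$: 1. if $A=B=2$, then $\tilde\nu(\mathbf p)\le(2K_G+1)\,\tilde\gamma_2(\mathbf p)$; 2. for any $A,B$, $\tilde\nu(\mathbf p)\le[2AB(K_G+1)-1]\,\tilde\gamma_2(\mathbf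 p)$. -/

import Mathlib

namespace Bipartite

/-- A real table `p x y a b`, read as `p(a, b | x, y)`: inputs `x, y`, outcomes `a, b`. -/
abbrev Table (X Y A B : Type*) : Type _ := X → Y → A → B → ℝ

/-- Non-signaling distributions: for all inputs `x, y` a probability distribution on `A × B`,
such that the marginal on `A` does not depend on `y` and the one on `B` does not depend on `x`. -/
structure IsNonSignaling {X Y A B : Type*} [Fintype A] [Fintype B] (p : Table X Y A B) :
    Prop where
  nonneg : ∀ x y a b, 0 ≤ p x y a b
  sum_eq_one : ∀ x y, ∑ a, ∑ b, p x y a b = 1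
  marginal_left : ∀ a x y y', ∑ b, p x y a b = ∑ b, p x y' a b
  marginal_right : ∀ b x x' y, ∑ a, p x y a b = ∑ a, p x' y a b

open Classical in
/-- The local deterministic distribution in which the outcomes are `f x` and `g y`. -/
noncomputable def deterministic {X Y A B : Type*} (f : X → A) (g : Y → B) : Table X Y A B :=
  fun x y a b => (if a = f x then 1 else 0) * (if b = g y then 1 else 0)

/-- Local distributions: convex combinations of local deterministic distributions. -/
def localSet (X Y A B : Type*) : Set (Table X Y A B) :=
  convexHull ℝ {p | ∃ (f : X → A) (g : Y → B), p = deterministic f g}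

/-- A projective measurement with outcomes in `A` on the complex Hilbert space `H`. -/
structure IsProjectiveMeasurement {A H : Type*} [Fintype A] [NormedAddCommGroup H]
    [InnerProductSpace ℂ H] [CompleteSpace H] (E : A → (H →L[ℂ] H)) : Prop where
  selfAdjoint : ∀ a, IsSelfAdjoint (E a)
  mul_self : ∀ a, E a * E a = E a
  mul_of_ne : ∀ a a', a ≠ a' → E a * E a' = 0
  sum_eq_one : ∑ a, E a = 1

/-- Quantum distributions: `p(a, b | x, y) = ⟨ψ, E_a(x) F_b(y) ψ⟩` for a unit vector `ψ` of a
complex Hilbert space of any dimension, and commuting projective measurements `E(x)`, `F(y)`.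
Asking for `H : Type` loses no generality when the index types are finite: `ψ` generates a
separable closed subspace invariant under all operators, and it is isometric to a space in `Type`. -/
def IsQuantum {X Y A B : Type*} [Fintype A] [Fintype B] (p : Table X Y A B) : Prop :=
  ∃ (H : Type) (_ : NormedAddCommGroup H) (_ : InnerProductSpace ℂ H) (_ : CompleteSpace H)
    (ψ : H) (E : X → A → (H →L[ℂ] H)) (F : Y → B → (H →L[ℂ] H)),
    ‖ψ‖ = 1 ∧
    (∀ x, IsProjectiveMeasurement (E x)) ∧
    (∀ y, IsProjectiveMeasurement (F y)) ∧
    (∀ x y a b, E x a * F y b = F y b * E x a) ∧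
    ∀ x y a b, (p x y a b : ℂ) = inner ℂ ψ (E x a (F y b ψ))

/-- The set of quantum distributions. -/
def quantumSet (X Y A B : Type*) [Fintype A] [Fintype B] : Set (Table X Y A B) :=
  {p | IsQuantum p}

/-- The values `∑ i, |q i|` over all finite decompositions `p = ∑ i, q i • P i` with real `q i`
and all `P i` in `S`. -/
def modelCosts {X Y A B : Type*} (S : Set (Table X Y A B)) (p : Table X Y A B) : Set ℝ :=
  {c | ∃ (n : ℕ) (q : Fin n → ℝ) (P : Fin n → Table X Y A B),
    (∀ i, P i ∈ S) ∧ p = ∑ i, q i • P i ∧ c = ∑ i, |q i|}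

/-- The least cost of an affine model by local distributions. -/
noncomputable def nuTilde {X Y A B : Type*} (p : Table X Y A B) : ℝ :=
  sInf (modelCosts (localSet X Y A B) p)

/-- The least cost of an affine model by quantum distributions. -/
noncomputable def gammaTilde {X Y A B : Type*} [Fintype A] [Fintype B] (p : Table X Y A B) : ℝ :=
  sInf (modelCosts (quantumSet X Y A B) p)

/-- Grothendieck's inequality with constant `K`: for every real matrix `M` such that
`|∑ i j, M i j * s i * t j| ≤ 1` for all signs `s i, t j`, one has
`|∑ i j, M i j * ⟨u i, v j⟩| ≤ K` for all unit vectors `u i, v j` of a real Euclidean space. -/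
def GrothendieckBound (K : ℝ) : Prop :=
  ∀ (m n : ℕ) (M : Matrix (Fin m) (Fin n) ℝ),
    (∀ (s : Fin m → ℝ) (t : Fin n → ℝ), (∀ i, s i = 1 ∨ s i = -1) → (∀ j, t j = 1 ∨ t j = -1) →
      |∑ i, ∑ j, M i j * (s i * t j)| ≤ 1) →
    ∀ (d : ℕ) (u : Fin m → EuclideanSpace ℝ (Fin d)) (v : Fin n → EuclideanSpace ℝ (Fin d)),
      (∀ i, ‖u i‖ = 1) → (∀ j, ‖v j‖ = 1) →
      |∑ i, ∑ j, M i j * inner ℝ (u i) (v j)| ≤ K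

/-- The (real) Grothendieck constant, the least `K` for which Grothendieck's inequality holds. -/
noncomputable def grothendieckConstant : ℝ := sInf {K | GrothendieckBound K}

/-! The next facts show that `nuTilde` and `gammaTilde` of a non-signaling distribution are
infima of nonempty sets of nonnegative reals. -/

theorem modelCosts_nonneg {X Y A B : Type*} {S : Set (Table X Y A B)} {p : Table X Y A B} {c : ℝ}
    (hc : c ∈ modelCosts S p) : 0 ≤ c := by
  obtain ⟨n, q, P, -, -, rfl⟩ := hc
  exact Finset.sum_nonneg fun i _ => abs_nonneg _

theorem modelCosts_nonempty_of_mem_span {X Y A B : Type*} {S : Set (Table X Y A B)}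
    {p : Table X Y A B} (hp : p ∈ Submodule.span ℝ S) : (modelCosts S p).Nonempty := by
  obtain ⟨n, q, P, h⟩ := Submodule.mem_span_set'.1 hp
  exact ⟨_, n, q, fun i => (P i : Table X Y A B), fun i => (P i).2, h.symm, rfl⟩

theorem deterministic_mem_localSet {X Y A B : Type*} (f : X → A) (g : Y → B) :
    deterministic f g ∈ localSet X Y A B :=
  subset_convexHull ℝ _ ⟨f, g, rfl⟩

theorem isProjectiveMeasurement_ite {C : Type*} [Fintype C] [DecidableEq C] (c : C) :
    IsProjectiveMeasurement (fun a : C => if a = c then (1 : ℂ →L[ℂ] ℂ) else 0) := by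
  refine ⟨fun a => ?_, fun a => ?_, fun a a' h => ?_, by simp⟩
  · split_ifs <;> simp
  · split_ifs <;> simp
  · split_ifs <;> simp_all

theorem deterministic_mem_quantumSet {X Y A B : Type*} [Fintype A] [Fintype B]
    (f : X → A) (g : Y → B) : deterministic f g ∈ quantumSet X Y A B := by
  classical
  refine ⟨ℂ, inferInstance, inferInstance, inferInstance, 1,
    fun x a => if a = f x then 1 else 0, fun y b => if b = g y then 1 else 0,
    by simp, fun x => isProjectiveMeasurement_ite (f x), fun y => isProjectiveMeasurement_ite (g y), fun x y a b => ?_, fun x y a b => ?_⟩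
  · beta_reduce
    split_ifs <;> simp
  · simp only [deterministic]
    split_ifs <;> simp

theorem sum_update {I C : Type*} [Fintype I] [Fintype C] [DecidableEq I] [DecidableEq C]
    (u : I → C → ℝ) (c₀ : C) (i : I) (c : C) :
    ∑ j, ∑ d, u j d * ((if c = Function.update (fun _ => c₀) j d i then 1 else 0)
      - (if c = c₀ then 1 else 0)) = u i c - (if c = c₀ then ∑ d, u i d else 0) := by
  rw [Finset.sum_eq_single i]
  · simp only [Function.update_self, mul_sub, Finset.sum_sub_distrib]
    simp
  · intro j _ hj
    simp [Function.update_of_ne (Ne.symm hj)]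
  · simp

theorem mem_span_deterministic {X Y A B : Type*} [Fintype X] [Fintype Y] [Fintype A] [Fintype B]
    {p : Table X Y A B} (hp : IsNonSignaling p) :
    p ∈ Submodule.span ℝ {p : Table X Y A B | ∃ f g, p = deterministic f g} := by
  classical
  rcases isEmpty_or_nonempty X with hX | ⟨⟨x₀⟩⟩
  · rw [Subsingleton.elim p 0]
    exact Submodule.zero_mem _
  rcases isEmpty_or_nonempty Y with hY | ⟨⟨y₀⟩⟩
  · rw [Subsingleton.elim p 0]
    exact Submodule.zero_mem _
  have hA : Nonempty A := by
    by_contra h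
    rw [not_nonempty_iff] at h
    simpa using hp.sum_eq_one x₀ y₀
  have hB : Nonempty B := by
    by_contra h
    rw [not_nonempty_iff] at h
    simpa using hp.sum_eq_one x₀ y₀
  obtain ⟨a₀⟩ := hA
  obtain ⟨b₀⟩ := hB
  let f : X → A → X → A := fun x a => Function.update (fun _ => a₀) x a
  let g : Y → B → Y → B := fun y b => Function.update (fun _ => b₀) y b
  let f₀ : X → A := fun _ => a₀
  let g₀ : Y → B := fun _ => b₀
  have hD : ∀ (f : X → A) (g : Y → B), deterministic f g ∈
      Submodule.span ℝ {p : Table X Y A B | ∃ f g, p = deterministic f g} :=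
    fun f g => Submodule.subset_span ⟨f, g, rfl⟩
  have hdec : p =
      (∑ x, ∑ a, ∑ y, ∑ b, p x y a b • (deterministic (f x a) (g y b) - deterministic f₀ (g y b)
        - deterministic (f x a) g₀ + deterministic f₀ g₀))
      + (∑ x, ∑ a, (∑ b, p x y₀ a b) • (deterministic (f x a) g₀ - deterministic f₀ g₀))
      + (∑ y, ∑ b, (∑ a, p x₀ y a b) • (deterministic f₀ (g y b) - deterministic f₀ g₀))
      + deterministic f₀ g₀ := by
    funext x y a b
    have h1 : ∑ x', ∑ a', ∑ y', ∑ b', p x' y' a' b' *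
        (deterministic (f x' a') (g y' b') x y a b - deterministic f₀ (g y' b') x y a b
          - deterministic (f x' a') g₀ x y a b + deterministic f₀ g₀ x y a b)
        = p x y a b - (if b = b₀ then ∑ b', p x y a b' else 0)
          - (if a = a₀ then ∑ a', (p x y a' b - (if b = b₀ then ∑ b', p x y a' b' else 0))
            else 0) := by
      rw [← sum_update (fun x a => p x y a b - (if b = b₀ then ∑ b', p x y a b' else 0)) a₀ x a]
      refine Finset.sum_congr rfl fun x' _ => Finset.sum_congr rfl fun a' _ => ?_
      rw [← sum_update (fun y b => p x' y a' b) b₀ y b, Finset.sum_mul]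
      refine Finset.sum_congr rfl fun y' _ => ?_
      rw [Finset.sum_mul]
      refine Finset.sum_congr rfl fun b' _ => ?_
      simp only [deterministic, f, g, f₀, g₀]
      ring
    have h2 : ∑ x', ∑ a', (∑ b', p x' y₀ a' b') *
        (deterministic (f x' a') g₀ x y a b - deterministic f₀ g₀ x y a b)
        = ((∑ b', p x y₀ a b') - (if a = a₀ then ∑ a', ∑ b', p x y₀ a' b' else 0)) *
          (if b = b₀ then 1 else 0) := by
      rw [← sum_update (fun x a => ∑ b', p x y₀ a b') a₀ x a, Finset.sum_mul]
      refine Finset.sum_congr rfl fun x' _ => ?_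
      rw [Finset.sum_mul]
      refine Finset.sum_congr rfl fun a' _ => ?_
      simp only [deterministic, f, f₀, g₀]
      ring
    have h3 : ∑ y', ∑ b', (∑ a', p x₀ y' a' b') *
        (deterministic f₀ (g y' b') x y a b - deterministic f₀ g₀ x y a b)
        = ((∑ a', p x₀ y a' b) - (if b = b₀ then ∑ b', ∑ a', p x₀ y a' b' else 0)) *
          (if a = a₀ then 1 else 0) := by
      rw [← sum_update (fun y b => ∑ a', p x₀ y a' b) b₀ y b, Finset.sum_mul]
      refine Finset.sum_congr rfl fun y' _ => ?_
      rw [Finset.sum_mul]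
      refine Finset.sum_congr rfl fun b' _ => ?_
      simp only [deterministic, g, f₀, g₀]
      ring
    simp only [Pi.add_apply, Finset.sum_apply, Pi.smul_apply, smul_eq_mul, Pi.sub_apply]
    rw [h1, h2, h3, hp.marginal_left a x y₀ y, hp.marginal_right b x₀ x y,
      hp.sum_eq_one x y₀, Finset.sum_comm (f := fun b' a' => p x₀ y a' b'), hp.sum_eq_one x₀ y]
    have h4 := hp.sum_eq_one x y
    simp only [deterministic, f₀, g₀, Finset.sum_sub_distrib]
    clear h1 h2 h3
    split_ifs <;> subst_vars <;> (try simp only [h4, Finset.sum_const_zero]) <;> ring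
  rw [hdec]
  refine Submodule.add_mem _ (Submodule.add_mem _ (Submodule.add_mem _ ?_ ?_) ?_) (hD _ _)
  · refine Submodule.sum_mem _ fun x _ => Submodule.sum_mem _ fun a _ =>
      Submodule.sum_mem _ fun y _ => Submodule.sum_mem _ fun b _ => Submodule.smul_mem _ _ ?_
    exact Submodule.add_mem _ (Submodule.sub_mem _ (Submodule.sub_mem _ (hD _ _) (hD _ _))
      (hD _ _)) (hD _ _)
  · exact Submodule.sum_mem _ fun x _ => Submodule.sum_mem _ fun a _ =>
      Submodule.smul_mem _ _ (Submodule.sub_mem _ (hD _ _) (hD _ _))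
  · exact Submodule.sum_mem _ fun y _ => Submodule.sum_mem _ fun b _ =>
      Submodule.smul_mem _ _ (Submodule.sub_mem _ (hD _ _) (hD _ _))

theorem modelCosts_localSet_nonempty {X Y A B : Type*} [Fintype X] [Fintype Y] [Fintype A]
    [Fintype B] {p : Table X Y A B} (hp : IsNonSignaling p) :
    (modelCosts (localSet X Y A B) p).Nonempty := by
  refine modelCosts_nonempty_of_mem_span (Submodule.span_mono ?_ (mem_span_deterministic hp))
  rintro _ ⟨f, g, rfl⟩
  exact deterministic_mem_localSet f g

theorem modelCosts_quantumSet_nonempty {X Y A B : Type*} [Fintype X] [Fintype Y] [Fintype A]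
    [Fintype B] {p : Table X Y A B} (hp : IsNonSignaling p) :
    (modelCosts (quantumSet X Y A B) p).Nonempty := by
  refine modelCosts_nonempty_of_mem_span (Submodule.span_mono ?_ (mem_span_deterministic hp))
  rintro _ ⟨f, g, rfl⟩
  exact deterministic_mem_quantumSet f g

end Bipartite

/-! A quantum table is a table of real inner products of `u x a = E x a ψ` and `v y b = F y b ψ`,
two resolutions of the unit vector `ψ`. Removing the components along `ψ` writes it as the product
of its marginals, which is local, plus a table `D` of inner products with vanishing marginals. The
remaining vectors have norm at most 1/2, since `α - α² ≤ 1/4`.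

By duality, Grothendieck's inequality turns each matrix `D · · a₁ b₁` into `K / 4` times a convex
combination of rank-one sign matrices (`GrothendieckBound.mem_convexHull`). A sign matrix tensored
with differences of point masses is a signed sum of four deterministic tables
(`tensorRight_mem_costBall`). Expanding `D` over the `(A - 1)(B - 1)` pairs of outcomes other than a
reference pair gives local cost at most `1 + (A - 1)(B - 1)K`, which is below both claimed factors.
The bound passes to affine combinations of quantum tables by composing models.

The constant is an infimum, so some finite `K` must first be shown to work; a truncation argument
gives 98. -/

namespace Bipartite

/-! ### Grothendieck's inequality with a finite constant -/

/-- Finite Rademacher sums: covariances and the fourth moment bound. -/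
theorem exists_rademacher (d : ℕ) : ∃ (Ω : Type) (_ : Fintype Ω) (_ : Nonempty Ω)
    (Z : (Fin d → ℝ) → Ω → ℝ),
    (∀ u v, ∑ ω, Z u ω * Z v ω = Fintype.card Ω * ∑ k, u k * v k) ∧
    ∀ u, ∑ ω, Z u ω ^ 4 ≤ 3 * Fintype.card Ω * (∑ k, u k ^ 2) ^ 2 := by
  induction d with
  | zero => exact ⟨Unit, inferInstance, inferInstance, fun _ _ => 0, by simp, by simp⟩
  | succ d ih =>
    obtain ⟨Ω, _, _, Z, h2, h4⟩ := ih
    refine ⟨Ω × Bool, inferInstance, inferInstance,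
      -- A new independent sign carries coordinate 0; odd powers of it cancel in all moments.
      fun u ω => Z (Fin.tail u) ω.1 + (if ω.2 then 1 else -1) * u 0, fun u v => ?_, fun u => ?_⟩
    · have h := h2 (Fin.tail u) (Fin.tail v)
      simp only [Fintype.sum_prod_type, Fintype.sum_bool, Fintype.card_prod, Fintype.card_bool,
        Fin.sum_univ_succ]
      calc _ = ∑ ω, (2 * (Z (Fin.tail u) ω * Z (Fin.tail v) ω) + 2 * (u 0 * v 0)) := by
            refine Finset.sum_congr rfl fun ω _ => ?_
            simp only [if_true, Bool.false_eq_true, if_false]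
            ring
        _ = _ := by
            rw [Finset.sum_add_distrib, ← Finset.mul_sum, h]
            simp only [Finset.sum_const, Finset.card_univ, nsmul_eq_mul, Fin.tail]
            push_cast
            ring
    · have h := h2 (Fin.tail u) (Fin.tail u)
      have h' := h4 (Fin.tail u)
      simp only [Fintype.sum_prod_type, Fintype.sum_bool, Fintype.card_prod, Fintype.card_bool,
        Fin.sum_univ_succ]
      have hN : ∑ k, Fin.tail u k * Fin.tail u k = ∑ k, Fin.tail u k ^ 2 :=
        Finset.sum_congr rfl fun _ _ => by ring
      rw [hN] at h
      change _ ≤ 3 * _ * (u 0 ^ 2 + ∑ k, Fin.tail u k ^ 2) ^ 2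
      set N := ∑ k, Fin.tail u k ^ 2
      calc _ = ∑ ω, (2 * Z (Fin.tail u) ω ^ 4
              + 12 * u 0 ^ 2 * (Z (Fin.tail u) ω * Z (Fin.tail u) ω) + 2 * u 0 ^ 4) := by
            refine Finset.sum_congr rfl fun ω _ => ?_
            simp only [if_true, Bool.false_eq_true, if_false]
            ring
        _ ≤ _ := by
            rw [Finset.sum_add_distrib, Finset.sum_add_distrib, ← Finset.mul_sum,
              ← Finset.mul_sum, h]
            simp only [Finset.sum_const, Finset.card_univ, nsmul_eq_mul]
            push_cast
            have : 0 ≤ (Fintype.card Ω : ℝ) * u 0 ^ 4 := by positivity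
            linarith

/-- A bilinear form bounded by `1` on signs is bounded by `1` on the cube. -/
theorem le_one_of_abs_le_one {m n : Type*} [Fintype m] [Fintype n] {M : m → n → ℝ}
    (hM : ∀ (s : m → ℝ) (t : n → ℝ), (∀ i, s i = 1 ∨ s i = -1) → (∀ j, t j = 1 ∨ t j = -1) →
      |∑ i, ∑ j, M i j * (s i * t j)| ≤ 1)
    {a : m → ℝ} {b : n → ℝ} (ha : ∀ i, |a i| ≤ 1) (hb : ∀ j, |b j| ≤ 1) :
    ∑ i, ∑ j, M i j * (a i * b j) ≤ 1 := by
  have key : ∀ {x c : ℝ}, |x| ≤ 1 → c * x ≤ c * (if 0 ≤ c then 1 else -1) := by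
    intro x c hx
    have := abs_le.1 hx
    split_ifs with h <;> nlinarith
  -- The form is affine in each variable: `b` is first replaced by the best signs `t` for `a`, then
  -- `a` by the best signs `s` for `t`.
  let t : n → ℝ := fun j => if 0 ≤ ∑ i, M i j * a i then 1 else -1
  let s : m → ℝ := fun i => if 0 ≤ ∑ j, M i j * t j then 1 else -1
  calc ∑ i, ∑ j, M i j * (a i * b j) = ∑ j, (∑ i, M i j * a i) * b j := by
        rw [Finset.sum_comm]
        refine Finset.sum_congr rfl fun j _ => ?_
        rw [Finset.sum_mul]
        exact Finset.sum_congr rfl fun i _ => by ring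
    _ ≤ ∑ j, (∑ i, M i j * a i) * t j := Finset.sum_le_sum fun j _ => key (hb j)
    _ = ∑ i, (∑ j, M i j * t j) * a i := by
        simp only [Finset.sum_mul]
        rw [Finset.sum_comm]
        exact Finset.sum_congr rfl fun i _ => Finset.sum_congr rfl fun j _ => by ring
    _ ≤ ∑ i, (∑ j, M i j * t j) * s i := Finset.sum_le_sum fun i _ => key (ha i)
    _ = ∑ i, ∑ j, M i j * (s i * t j) := by
        refine Finset.sum_congr rfl fun i _ => ?_
        rw [Finset.sum_mul]
        exact Finset.sum_congr rfl fun j _ => by ring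
    _ ≤ 1 := by
        refine (abs_le.1 (hM s t (fun i => ?_) fun j => ?_)).2
        · simp only [s]; split_ifs <;> simp
        · simp only [t]; split_ifs <;> simp

/-- The values `∑ i j, M i j * ⟨u i, v j⟩` at vectors in the unit balls of Euclidean spaces. -/
def gramValues {m n : Type*} [Fintype m] [Fintype n] (M : m → n → ℝ) : Set ℝ :=
  {r | ∃ (d : ℕ) (u : m → Fin d → ℝ) (v : n → Fin d → ℝ),
    (∀ i, ∑ k, u i k ^ 2 ≤ 1) ∧ (∀ j, ∑ k, v j k ^ 2 ≤ 1) ∧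
    r = ∑ i, ∑ j, M i j * ∑ k, u i k * v j k}

theorem bddAbove_gramValues {m n : Type*} [Fintype m] [Fintype n] (M : m → n → ℝ) :
    BddAbove (gramValues M) := by
  refine ⟨∑ i, ∑ j, |M i j|, ?_⟩
  rintro _ ⟨d, u, v, hu, hv, rfl⟩
  refine Finset.sum_le_sum fun i _ => Finset.sum_le_sum fun j _ => ?_
  refine (le_abs_self _).trans ?_
  rw [abs_mul]
  refine mul_le_of_le_one_right (abs_nonneg _) ?_
  have h1 : ∑ k, |u i k * v j k| ≤ ∑ k, (u i k ^ 2 + v j k ^ 2) / 2 := by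
    refine Finset.sum_le_sum fun k _ => ?_
    rw [abs_le]
    constructor <;> nlinarith [sq_nonneg (u i k + v j k), sq_nonneg (u i k - v j k)]
  rw [← Finset.sum_div, Finset.sum_add_distrib] at h1
  linarith [Finset.abs_sum_le_sum_abs (fun k => u i k * v j k) Finset.univ, hu i, hv j]

/-- By homogeneity the supremum also controls vectors indexed by any finite type. In particular,
functions on a sample space count as vectors, which lets the supremum be estimated in terms of
itself. -/
theorem sum_le_mul_sSup_gramValues {m n ι : Type*} [Fintype m] [Fintype n] [Fintype ι]
    (M : m → n → ℝ) {c e : ℝ} (hc : 0 < c) (he : 0 < e) (u : m → ι → ℝ) (v : n → ι → ℝ)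
    (hu : ∀ i, ∑ k, u i k ^ 2 ≤ c ^ 2) (hv : ∀ j, ∑ k, v j k ^ 2 ≤ e ^ 2) :
    ∑ i, ∑ j, M i j * ∑ k, u i k * v j k ≤ c * e * sSup (gramValues M) := by
  let φ := (Fintype.equivFin ι).symm
  have hmem : ∑ i, ∑ j, M i j * ∑ k, (u i (φ k) / c) * (v j (φ k) / e) ∈ gramValues M := by
    refine ⟨_, fun i k => u i (φ k) / c, fun j k => v j (φ k) / e, fun i => ?_, fun j => ?_, rfl⟩
    · simp only [div_pow]
      rw [φ.sum_comp (fun k => u i k ^ 2 / c ^ 2), ← Finset.sum_div]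
      exact (div_le_one (by positivity)).2 (hu i)
    · simp only [div_pow]
      rw [φ.sum_comp (fun k => v j k ^ 2 / e ^ 2), ← Finset.sum_div]
      exact (div_le_one (by positivity)).2 (hv j)
  have h := mul_le_mul_of_nonneg_left (le_csSup (bddAbove_gramValues M) hmem)
    (by positivity : 0 ≤ c * e)
  refine le_of_eq_of_le ?_ h
  simp only [Finset.mul_sum]
  refine Finset.sum_congr rfl fun i _ => Finset.sum_congr rfl fun j _ => ?_
  rw [← φ.sum_comp]
  refine Finset.sum_congr rfl fun k _ => ?_
  field_simp

/-- Grothendieck's inequality, for vectors in unit balls. -/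
theorem gramValues_le {m n : Type*} [Fintype m] [Fintype n] {M : m → n → ℝ}
    (hM : ∀ (s : m → ℝ) (t : n → ℝ), (∀ i, s i = 1 ∨ s i = -1) → (∀ j, t j = 1 ∨ t j = -1) →
      |∑ i, ∑ j, M i j * (s i * t j)| ≤ 1) {r : ℝ} (hr : r ∈ gramValues M) : r ≤ 98 := by
  set S := sSup (gramValues M)
  -- Inner products become covariances of Rademacher sums, cut at height 7. The bounded parts
  -- contribute at most `7²`, and each of the two terms containing a tail at most `S / 4`.
  have step : ∀ r ∈ gramValues M, r ≤ 49 + S / 2 := by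
    rintro _ ⟨d, u, v, hu, hv, rfl⟩
    obtain ⟨Ω, _, _, Z, h2, h4⟩ := exists_rademacher d
    have hN : 0 < (Fintype.card Ω : ℝ) := by exact_mod_cast Fintype.card_pos
    set N : ℝ := (Fintype.card Ω : ℝ)
    let lo : ℝ → ℝ := fun x => if x ^ 2 ≤ 49 then x else 0
    let hi : ℝ → ℝ := fun x => if x ^ 2 ≤ 49 then 0 else x
    have hlohi : ∀ x, lo x + hi x = x := fun x => by simp only [lo, hi]; split_ifs <;> simp
    have hlo : ∀ x, |lo x / 7| ≤ 1 := fun x => by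
      rw [← sq_le_one_iff_abs_le_one, div_pow]
      simp only [lo]; split_ifs <;> linarith
    have hlo2 : ∀ x, lo x ^ 2 ≤ x ^ 2 := fun x => by
      simp only [lo]; split_ifs
      · exact le_rfl
      · nlinarith [sq_nonneg x]
    have hhi : ∀ x, hi x ^ 2 ≤ x ^ 4 / 49 := fun x => by
      simp only [hi]; split_ifs
      · simp only [ne_eq, OfNat.ofNat_ne_zero, not_false_eq_true, zero_pow]; positivity
      · nlinarith [sq_nonneg x]
    set c := √N
    have hc0 : 0 < c := Real.sqrt_pos.2 hN
    have hc2 : c ^ 2 = N := Real.sq_sqrt hN.le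
    have hZ2 : ∀ w : Fin d → ℝ, ∑ k, w k ^ 2 ≤ 1 → ∑ ω, Z w ω ^ 2 ≤ c ^ 2 := fun w hw => by
      rw [hc2]
      have := h2 w w
      simp only [← sq] at this
      rw [this]
      exact mul_le_of_le_one_right hN.le hw
    have hZlo : ∀ w : Fin d → ℝ, ∑ k, w k ^ 2 ≤ 1 → ∑ ω, lo (Z w ω) ^ 2 ≤ c ^ 2 :=
      fun w hw => (Finset.sum_le_sum fun ω _ => hlo2 _).trans (hZ2 w hw)
    -- The tail has mean square at most `3 / 49`, by the fourth moment, and `3 / 49 ≤ 1 / 16`.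
    have hZhi : ∀ w : Fin d → ℝ, ∑ k, w k ^ 2 ≤ 1 → ∑ ω, hi (Z w ω) ^ 2 ≤ (c / 4) ^ 2 :=
      fun w hw => by
      refine (Finset.sum_le_sum fun ω _ => hhi _).trans ?_
      rw [← Finset.sum_div, div_pow, hc2]
      have h1 : (∑ k, w k ^ 2) ^ 2 ≤ 1 :=
        pow_le_one₀ (Finset.sum_nonneg fun k _ => sq_nonneg _) hw
      have h3 := h4 w
      have := mul_le_mul_of_nonneg_left h1 (by positivity : 0 ≤ 3 * N)
      linarith
    have e1 := sum_le_mul_sSup_gramValues M (by positivity : 0 < c / 4) hc0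
      (fun i ω => hi (Z (u i) ω)) (fun j ω => lo (Z (v j) ω))
      (fun i => hZhi _ (hu i)) (fun j => hZlo _ (hv j))
    have e2 := sum_le_mul_sSup_gramValues M hc0 (by positivity : 0 < c / 4)
      (fun i ω => Z (u i) ω) (fun j ω => hi (Z (v j) ω))
      (fun i => hZ2 _ (hu i)) (fun j => hZhi _ (hv j))
    have e3 : ∑ i, ∑ j, M i j * ∑ ω, lo (Z (u i) ω) * lo (Z (v j) ω) ≤ N * 49 := by
      calc _ = ∑ ω, 49 * ∑ i, ∑ j, M i j * (lo (Z (u i) ω) / 7 * (lo (Z (v j) ω) / 7)) := by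
            simp only [Finset.mul_sum]
            rw [Finset.sum_comm]
            refine Eq.trans ?_ (Finset.sum_congr rfl fun ω _ => Finset.sum_comm)
            rw [Finset.sum_comm (s := (Finset.univ : Finset Ω))]
            refine Finset.sum_congr rfl fun i _ => ?_
            rw [Finset.sum_comm]
            refine Finset.sum_congr rfl fun ω _ => Finset.sum_congr rfl fun j _ => ?_
            ring
        _ ≤ ∑ ω : Ω, 49 * 1 := Finset.sum_le_sum fun ω _ => mul_le_mul_of_nonneg_left
            (le_one_of_abs_le_one hM (fun i => hlo _) fun j => hlo _) (by norm_num)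
        _ = N * 49 := by simp [N]
    have e4 : N * ∑ i, ∑ j, M i j * ∑ k, u i k * v j k
        = ∑ i, ∑ j, M i j * ∑ ω, lo (Z (u i) ω) * lo (Z (v j) ω)
          + ∑ i, ∑ j, M i j * ∑ ω, hi (Z (u i) ω) * lo (Z (v j) ω)
          + ∑ i, ∑ j, M i j * ∑ ω, Z (u i) ω * hi (Z (v j) ω) := by
      rw [Finset.mul_sum, ← Finset.sum_add_distrib, ← Finset.sum_add_distrib]
      refine Finset.sum_congr rfl fun i _ => ?_
      rw [Finset.mul_sum, ← Finset.sum_add_distrib, ← Finset.sum_add_distrib]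
      refine Finset.sum_congr rfl fun j _ => ?_
      rw [mul_left_comm, ← h2, ← mul_add, ← mul_add, ← Finset.sum_add_distrib,
        ← Finset.sum_add_distrib]
      congr 1
      refine Finset.sum_congr rfl fun ω _ => ?_
      linear_combination (-lo (Z (v j) ω)) * hlohi (Z (u i) ω) - Z (u i) ω * hlohi (Z (v j) ω)
    have e5 : c / 4 * c = N / 4 := by rw [← hc2]; ring
    have e6 : c * (c / 4) = N / 4 := by rw [← hc2]; ring
    rw [e5] at e1
    rw [e6] at e2
    refine le_of_mul_le_mul_left ?_ hN
    rw [e4]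
    linarith
  -- Since `S` is finite, `S / 2` can be absorbed.
  have hS' : S ≤ 49 + S / 2 := csSup_le ⟨r, hr⟩ step
  linarith [le_csSup (bddAbove_gramValues M) hr]

theorem grothendieckBound_const : GrothendieckBound 98 := by
  intro m n M hM d u v hu hv
  have hsq : ∀ w : EuclideanSpace ℝ (Fin d), ‖w‖ = 1 → ∑ k, w k ^ 2 ≤ 1 := fun w hw => by
    rw [← EuclideanSpace.real_norm_sq_eq, hw, one_pow]
  have hin : ∀ x y : EuclideanSpace ℝ (Fin d), inner ℝ x y = ∑ k, x k * y k := fun x y => by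
    rw [PiLp.inner_apply]
    exact Finset.sum_congr rfl fun k _ => by simp [mul_comm]
  simp only [hin]
  rw [abs_le']
  refine ⟨gramValues_le hM ⟨d, fun i => u i, fun j => v j, fun i => hsq _ (hu i),
    fun j => hsq _ (hv j), rfl⟩, gramValues_le hM ⟨d, fun i k => -u i k, fun j => v j,
    fun i => by simpa using hsq _ (hu i), fun j => hsq _ (hv j), ?_⟩⟩
  simp [Finset.sum_neg_distrib]

/-- The infimum is attained, because each instance of the inequality is a closed condition on `K`;
the bound 98 makes the set nonempty. -/
theorem grothendieckBound_grothendieckConstant : GrothendieckBound grothendieckConstant := by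
  intro m n M hM d u v hu hv
  exact le_csInf ⟨98, grothendieckBound_const⟩ fun K hK => hK m n M hM d u v hu hv

theorem GrothendieckBound.one_le {K : ℝ} (hK : GrothendieckBound K) : 1 ≤ K := by
  have h := hK 1 1 (fun _ _ => 1) (fun s t hs ht => by
    rcases hs 0 with h | h <;> rcases ht 0 with h' | h' <;> simp [h, h'])
    1 (fun _ => EuclideanSpace.single 0 1) (fun _ => EuclideanSpace.single 0 1)
    (by simp) (by simp)
  simpa using h


/-! ### Duality for Grothendieck's inequality -/

/-- The rank-one sign matrices. -/
def signMatrices (I J : Type*) : Set (I → J → ℝ) :=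
  {T | ∃ (s : I → ℝ) (t : J → ℝ), (∀ i, s i = 1 ∨ s i = -1) ∧ (∀ j, t j = 1 ∨ t j = -1) ∧
    T = fun i j => s i * t j}

theorem finite_signs (L : Type*) [Finite L] : {s : L → ℝ | ∀ i, s i = 1 ∨ s i = -1}.Finite := by
  have := Set.Finite.pi' (ι := L) (t := fun _ => ({1, -1} : Set ℝ)) fun _ => Set.toFinite _
  simpa using this

theorem finite_signMatrices (I J : Type*) [Finite I] [Finite J] : (signMatrices I J).Finite := by
  refine ((finite_signs I).image2 (fun s t i j => s i * t j) (finite_signs J)).subset ?_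
  rintro _ ⟨s, t, hs, ht, rfl⟩
  exact ⟨s, hs, t, ht, rfl⟩

/-- Vectors of unit balls are the main components of unit vectors with the same inner products. -/
theorem exists_unit_vectors {I J H : Type*} [Finite I] [Finite J] [NormedAddCommGroup H]
    [InnerProductSpace ℝ H] (u : I → H) (v : J → H) (hu : ∀ i, ‖u i‖ ≤ 1) (hv : ∀ j, ‖v j‖ ≤ 1) :
    ∃ (d : ℕ) (u' : I → EuclideanSpace ℝ (Fin d)) (v' : J → EuclideanSpace ℝ (Fin d)),
      (∀ i, ‖u' i‖ = 1) ∧ (∀ j, ‖v' j‖ = 1) ∧ ∀ i j, inner ℝ (u' i) (v' j) = inner ℝ (u i) (v j) := by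
  -- Each family is padded to norm 1 in its own extra coordinate, so the cross inner products do not
  -- change.
  let H' := WithLp 2 (H × EuclideanSpace ℝ (Fin 2))
  let U : I → H' := fun i => WithLp.toLp 2 (u i, !₂[√(1 - ‖u i‖ ^ 2), 0])
  let V : J → H' := fun j => WithLp.toLp 2 (v j, !₂[0, √(1 - ‖v j‖ ^ 2)])
  have hU : ∀ i, ‖U i‖ = 1 := fun i => by
    rw [← sq_eq_sq₀ (norm_nonneg _) zero_le_one, WithLp.prod_norm_sq_eq_of_L2]
    have : ‖u i‖ ^ 2 ≤ 1 := pow_le_one₀ (norm_nonneg _) (hu i)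
    simp [U, EuclideanSpace.real_norm_sq_eq, Real.sq_sqrt (sub_nonneg.2 this)]
  have hV : ∀ j, ‖V j‖ = 1 := fun j => by
    rw [← sq_eq_sq₀ (norm_nonneg _) zero_le_one, WithLp.prod_norm_sq_eq_of_L2]
    have : ‖v j‖ ^ 2 ≤ 1 := pow_le_one₀ (norm_nonneg _) (hv j)
    simp [V, EuclideanSpace.real_norm_sq_eq, Real.sq_sqrt (sub_nonneg.2 this)]
  have hUV : ∀ i j, inner ℝ (U i) (V j) = inner ℝ (u i) (v j) := fun i j => by
    rw [WithLp.prod_inner_apply]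
    simp [U, V, PiLp.inner_apply]
  let W := Submodule.span ℝ (Set.range U ∪ Set.range V)
  have : FiniteDimensional ℝ W :=
    FiniteDimensional.span_of_finite ℝ ((Set.finite_range U).union (Set.finite_range V))
  have hUW : ∀ i, U i ∈ W := fun i => Submodule.subset_span (Or.inl ⟨i, rfl⟩)
  have hVW : ∀ j, V j ∈ W := fun j => Submodule.subset_span (Or.inr ⟨j, rfl⟩)
  let e := (stdOrthonormalBasis ℝ W).repr
  refine ⟨_, fun i => e ⟨U i, hUW i⟩, fun j => e ⟨V j, hVW j⟩, fun i => ?_, fun j => ?_,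
    fun i j => ?_⟩
  · rw [e.norm_map]; exact hU i
  · rw [e.norm_map]; exact hV j
  · exact (LinearIsometryEquiv.inner_map_map (𝕜 := ℝ) e _ _).trans (hUV i j)

/-- The dual form of Grothendieck's inequality: a matrix of inner products of vectors in unit
balls is `K` times a convex combination of rank-one sign matrices. -/
theorem GrothendieckBound.mem_convexHull {K : ℝ} (hK : GrothendieckBound K) {I J H : Type*}
    [Finite I] [Finite J] [NormedAddCommGroup H] [InnerProductSpace ℝ H] (u : I → H) (v : J → H)
    (hu : ∀ i, ‖u i‖ ≤ 1) (hv : ∀ j, ‖v j‖ ≤ 1) :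
    (fun i j => K⁻¹ * inner ℝ (u i) (v j)) ∈ convexHull ℝ (signMatrices I J) := by
  classical
  have := Fintype.ofFinite I
  have := Fintype.ofFinite J
  have hK0 : 0 < K := zero_lt_one.trans_le hK.one_le
  by_contra hG
  -- If the scaled Gram matrix lay outside the hull, the coefficients of a separating functional,
  -- divided by `c`, would form a matrix violating Grothendieck's inequality.
  obtain ⟨f, c, hfc, hcG⟩ := geometric_hahn_banach_closed_point (convex_convexHull ℝ _)
    ((finite_signMatrices I J).isClosed_convexHull (𝕜 := ℝ)) hG
  obtain ⟨d, u', v', hu', hv', huv⟩ := exists_unit_vectors u v hu hv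
  have hf : ∀ T : I → J → ℝ, f T = ∑ i, ∑ j, f (Pi.single i (Pi.single j 1)) * T i j := fun T => by
    have hT : T = ∑ i, ∑ j, T i j • Pi.single i (Pi.single j (1 : ℝ)) := by
      funext i j
      simp only [Finset.sum_apply, Pi.smul_apply]
      rw [Finset.sum_eq_single i, Finset.sum_eq_single j] <;>
        simp +contextual [Pi.single_apply, eq_comm]
    conv_lhs => rw [hT]
    simp only [map_sum, map_smul, smul_eq_mul, mul_comm]
  -- Sign matrices are closed under negation, so the one-sided separation bounds the absolute value.
  have hneg : ∀ T ∈ signMatrices I J, |f T| < c := by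
    rintro _ ⟨s, t, hs, ht, rfl⟩
    rw [abs_lt, neg_lt, ← map_neg]
    refine ⟨hfc _ (subset_convexHull ℝ _ ⟨fun i => -s i, t, fun i => ?_, ht, ?_⟩),
      hfc _ (subset_convexHull ℝ _ ⟨s, t, hs, ht, rfl⟩)⟩
    · rcases hs i with h | h <;> simp [h]
    · funext i j; simp
  have hc : 0 < c := (abs_nonneg _).trans_lt
    (hneg _ ⟨fun _ => 1, fun _ => 1, fun _ => Or.inl rfl, fun _ => Or.inl rfl, rfl⟩)
  let φ := (Fintype.equivFin I).symm
  let θ := (Fintype.equivFin J).symm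
  have hsum : ∀ T : I → J → ℝ, ∑ i, ∑ j, c⁻¹ * f (Pi.single (φ i) (Pi.single (θ j) 1))
      * T (φ i) (θ j) = c⁻¹ * f T := fun T => by
    rw [φ.sum_comp (fun i => ∑ j, c⁻¹ * f (Pi.single i (Pi.single (θ j) 1)) * T i (θ j)), hf T,
      Finset.mul_sum]
    refine Finset.sum_congr rfl fun i _ => ?_
    rw [θ.sum_comp (fun j => c⁻¹ * f (Pi.single i (Pi.single j 1)) * T i j), Finset.mul_sum]
    exact Finset.sum_congr rfl fun j _ => mul_assoc _ _ _
  have hb := hK _ _ (fun i j => c⁻¹ * f (Pi.single (φ i) (Pi.single (θ j) 1))) (fun s t hs ht => by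
    have h1 := hsum fun i j => s (φ.symm i) * t (θ.symm j)
    simp only [Equiv.symm_apply_apply] at h1
    rw [h1, abs_mul, abs_inv, abs_of_pos hc, inv_mul_le_iff₀ hc, mul_one]
    exact (hneg _ ⟨_, _, fun i => hs _, fun j => ht _, rfl⟩).le) d
    (fun i => u' (φ i)) (fun j => v' (θ j)) (fun i => hu' _) (fun j => hv' _)
  rw [hsum fun i j => inner ℝ (u' i) (v' j)] at hb
  simp only [huv] at hb
  have hG' : f (fun i j => K⁻¹ * inner ℝ (u i) (v j)) = K⁻¹ * f fun i j => inner ℝ (u i) (v j) := by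
    rw [← smul_eq_mul K⁻¹ (f _), ← map_smul]
    rfl
  rw [hG', lt_inv_mul_iff₀ hK0] at hcG
  have := (abs_le.1 hb).2
  rw [inv_mul_le_iff₀ hc] at this
  linarith


/-! ### Calculus of affine models -/

/-- The tables that have an affine model by members of `S` of cost at most `c`. -/
def costBall {X Y A B : Type*} (S : Set (Table X Y A B)) (c : ℝ) : Set (Table X Y A B) :=
  {p | ∃ c' ∈ modelCosts S p, c' ≤ c}

section costBall

variable {X Y A B : Type*} {S T : Set (Table X Y A B)} {p q : Table X Y A B} {c d : ℝ}

theorem costBall_mono (h : c ≤ d) : costBall S c ⊆ costBall S d :=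
  fun _ ⟨c', h1, h2⟩ => ⟨c', h1, h2.trans h⟩

theorem zero_mem_modelCosts : 0 ∈ modelCosts S 0 :=
  ⟨0, Fin.elim0, Fin.elim0, fun i => i.elim0, by simp, by simp⟩

theorem mem_costBall_one (hp : p ∈ S) : p ∈ costBall S 1 :=
  ⟨1, ⟨1, fun _ => 1, fun _ => p, fun _ => hp, by simp, by simp⟩, le_rfl⟩

theorem add_mem_costBall (hp : p ∈ costBall S c) (hq : q ∈ costBall S d) :
    p + q ∈ costBall S (c + d) := by
  obtain ⟨_, ⟨n, r, P, hP, rfl, rfl⟩, hc⟩ := hp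
  obtain ⟨_, ⟨n', r', P', hP', rfl, rfl⟩, hd⟩ := hq
  refine ⟨_, ⟨n + n', Fin.append r r', Fin.append P P', fun i => ?_, ?_, rfl⟩, ?_⟩
  · refine Fin.addCases (fun i => ?_) (fun i => ?_) i
    · rw [Fin.append_left]; exact hP i
    · rw [Fin.append_right]; exact hP' i
  · simp [Fin.sum_univ_add]
  · simpa [Fin.sum_univ_add] using add_le_add hc hd

theorem smul_mem_costBall (r : ℝ) (hp : p ∈ costBall S c) : r • p ∈ costBall S (|r| * c) := by
  obtain ⟨_, ⟨n, q, P, hP, rfl, rfl⟩, hc⟩ := hp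
  refine ⟨_, ⟨n, fun i => r * q i, P, hP, ?_, rfl⟩, ?_⟩
  · simp only [Finset.smul_sum, mul_smul]
  · simp only [abs_mul, ← Finset.mul_sum]
    exact mul_le_mul_of_nonneg_left hc (abs_nonneg r)

theorem sum_mem_costBall {ι : Type*} (s : Finset ι) {P : ι → Table X Y A B} {c : ι → ℝ}
    (h : ∀ i ∈ s, P i ∈ costBall S (c i)) : ∑ i ∈ s, P i ∈ costBall S (∑ i ∈ s, c i) := by
  classical
  induction s using Finset.induction_on with
  | empty => exact ⟨0, zero_mem_modelCosts, by simp⟩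
  | insert i s hi ih =>
    rw [Finset.sum_insert hi, Finset.sum_insert hi]
    exact add_mem_costBall (h i (Finset.mem_insert_self i s))
      (ih fun j hj => h j (Finset.mem_insert_of_mem hj))

theorem convex_costBall : Convex ℝ (costBall S c) := by
  intro p hp q hq a b ha hb hab
  have h := add_mem_costBall (smul_mem_costBall a hp) (smul_mem_costBall b hq)
  rwa [abs_of_nonneg ha, abs_of_nonneg hb, ← add_mul, hab, one_mul] at h

/-- Models compose: substituting a model of each member of `S` multiplies the costs. -/
theorem costBall_trans (hST : S ⊆ costBall T d) (hd : 0 ≤ d) (hp : p ∈ costBall S c) :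
    p ∈ costBall T (d * c) := by
  obtain ⟨_, ⟨n, q, P, hP, rfl, rfl⟩, hc⟩ := hp
  refine costBall_mono ?_
    (sum_mem_costBall Finset.univ fun i _ => smul_mem_costBall (q i) (hST (hP i)))
  rw [← Finset.sum_mul, mul_comm]
  exact mul_le_mul_of_nonneg_left hc hd

theorem sInf_modelCosts_le (hp : p ∈ costBall S c) : sInf (modelCosts S p) ≤ c := by
  obtain ⟨c', h, h'⟩ := hp
  exact (csInf_le ⟨0, fun _ => modelCosts_nonneg⟩ h).trans h'

theorem sInf_modelCosts_zero : sInf (modelCosts S 0) = 0 :=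
  le_antisymm (sInf_modelCosts_le ⟨0, zero_mem_modelCosts, le_rfl⟩)
    (Real.sInf_nonneg fun _ => modelCosts_nonneg)

end costBall

/-! ### Local models of product tables and sign matrices -/

section local_models

variable {X Y A B : Type*}

/-- The product of a matrix on the inputs with functions of the outcomes. -/
def tensorRight (φ : A → ℝ) (χ : B → ℝ) : (X → Y → ℝ) →ₗ[ℝ] Table X Y A B where
  toFun T x y a b := T x y * (φ a * χ b)
  map_add' T T' := by funext x y a b; simp only [Pi.add_apply]; ring
  map_smul' r T := by funext x y a b; simp only [Pi.smul_apply, smul_eq_mul, RingHom.id_apply]; ring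

/-- The product of the responses of the two parties. -/
def responseProduct : (X → A → ℝ) →ₗ[ℝ] (Y → B → ℝ) →ₗ[ℝ] Table X Y A B :=
  LinearMap.mk₂ ℝ (fun α β x y a b => α x a * β y b)
    (fun α α' β => by funext x y a b; simp only [Pi.add_apply]; ring)
    (fun r α β => by funext x y a b; simp only [Pi.smul_apply, smul_eq_mul]; ring)
    (fun α β β' => by funext x y a b; simp only [Pi.add_apply]; ring)
    (fun r α β => by funext x y a b; simp only [Pi.smul_apply, smul_eq_mul]; ring)

-- A product of simplices is the convex hull of the product of their vertex sets; choosing a vertex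
-- for each input amounts to choosing a response function.
open Classical in
theorem mem_convexHull_deterministic_responses [Finite X] [Fintype A] {α : X → A → ℝ}
    (hα : ∀ x, α x ∈ stdSimplex ℝ A) :
    α ∈ convexHull ℝ {d | ∃ f : X → A, d = fun x a => if a = f x then (1 : ℝ) else 0} := by
  have h : α ∈ convexHull ℝ (Set.univ.pi fun _ : X =>
      Set.range fun i j : A => if i = j then (1 : ℝ) else 0) := by
    rw [convexHull_pi]
    intro x _
    rw [convexHull_basis_eq_stdSimplex]
    exact hα x
  refine convexHull_mono (fun d hd => ?_) h
  choose f hf using fun x => hd x (Set.mem_univ x)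
  refine ⟨f, ?_⟩
  funext x a
  rw [← hf x]
  simp only [eq_comm]

/-- The product of two families of conditional distributions is local. -/
theorem responseProduct_mem_localSet [Finite X] [Finite Y] [Fintype A] [Fintype B]
    {α : X → A → ℝ} {β : Y → B → ℝ} (hα : ∀ x, α x ∈ stdSimplex ℝ A)
    (hβ : ∀ y, β y ∈ stdSimplex ℝ B) : responseProduct α β ∈ localSet X Y A B := by
  classical
  -- Bilinearity allows one party at a time to be decomposed; here the first is already
  -- deterministic.
  have h1 : ∀ f : X → A, responseProduct (fun x a => if a = f x then (1 : ℝ) else 0) β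
      ∈ localSet X Y A B := by
    intro f
    refine convexHull_min (t := responseProduct (fun x a => if a = f x then (1 : ℝ) else 0) ⁻¹'
      localSet X Y A B) ?_ ((convex_convexHull ℝ _).linear_preimage _)
      (mem_convexHull_deterministic_responses hβ)
    rintro _ ⟨g, rfl⟩
    rw [Set.mem_preimage]
    convert deterministic_mem_localSet f g using 1
    funext x y a b
    simp [responseProduct, deterministic]
  refine convexHull_min (t := responseProduct.flip β ⁻¹' localSet X Y A B) ?_
    ((convex_convexHull ℝ _).linear_preimage _) (mem_convexHull_deterministic_responses hα)
  rintro _ ⟨f, rfl⟩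
  exact h1 f

theorem sum_erase_mul_single_sub {C : Type*} [Fintype C] [DecidableEq C] {w : C → ℝ} (c₀ c : C)
    (hw : ∑ c, w c = 0) : ∑ c₁ ∈ Finset.univ.erase c₀,
      w c₁ * ((if c = c₁ then (1 : ℝ) else 0) - if c = c₀ then 1 else 0) = w c := by
  rw [Finset.sum_erase _ (by simp)]
  simp [mul_sub, Finset.sum_sub_distrib, hw]

variable [DecidableEq A] [DecidableEq B]

theorem tensorRight_mem_costBall (a₁ a₀ : A) (b₁ b₀ : B) {T : X → Y → ℝ}
    (hT : T ∈ convexHull ℝ (signMatrices X Y)) :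
    tensorRight (fun a => (if a = a₁ then (1 : ℝ) else 0) - if a = a₀ then 1 else 0)
      (fun b => (if b = b₁ then (1 : ℝ) else 0) - if b = b₀ then 1 else 0) T
      ∈ costBall (localSet X Y A B) 4 := by
  classical
  refine convexHull_min (t := tensorRight _ _ ⁻¹' costBall (localSet X Y A B) 4) ?_
    (convex_costBall.linear_preimage _) hT
  rintro _ ⟨s, t, hs, ht, rfl⟩
  -- `f'` and `g'` swap the two outcomes, so the difference of the point masses at `f x` and `f' x`
  -- is `s x` times the fixed difference at `a₁` and `a₀`. Multiplying out both parties gives four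
  -- deterministic tables with coefficients ±1.
  let f : X → A := fun x => if s x = 1 then a₁ else a₀
  let f' : X → A := fun x => if s x = 1 then a₀ else a₁
  let g : Y → B := fun y => if t y = 1 then b₁ else b₀
  let g' : Y → B := fun y => if t y = 1 then b₀ else b₁
  have hD : ∀ (f : X → A) (g : Y → B), deterministic f g ∈ costBall (localSet X Y A B) 1 :=
    fun f g => mem_costBall_one (deterministic_mem_localSet f g)
  have h := add_mem_costBall (add_mem_costBall (hD f g) (hD f' g'))
    (smul_mem_costBall (-1) (add_mem_costBall (hD f g') (hD f' g)))
  have e : (1 : ℝ) + 1 + |(-1 : ℝ)| * (1 + 1) = 4 := by norm_num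
  rw [e] at h
  rw [Set.mem_preimage]
  convert h using 1
  funext x y a b
  have h1 : (-1 : ℝ) ≠ 1 := by norm_num
  have hA : ((if a = f x then (1 : ℝ) else 0) - if a = f' x then 1 else 0)
      = s x * ((if a = a₁ then (1 : ℝ) else 0) - if a = a₀ then 1 else 0) := by
    rcases hs x with h | h <;> simp [f, f', h, h1]
  have hB : ((if b = g y then (1 : ℝ) else 0) - if b = g' y then 1 else 0)
      = t y * ((if b = b₁ then (1 : ℝ) else 0) - if b = b₀ then 1 else 0) := by
    rcases ht y with h | h <;> simp [g, g', h, h1]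
  simp only [tensorRight, LinearMap.coe_mk, AddHom.coe_mk, Pi.add_apply, Pi.smul_apply,
    smul_eq_mul, deterministic]
  rw [mul_mul_mul_comm, ← hA, ← hB]
  ring_nf

/-- A table with vanishing marginals, expanded in differences of point masses. -/
theorem eq_sum_tensorRight [Fintype A] [Fintype B] (a₀ : A) (b₀ : B) {D : Table X Y A B}
    (hA : ∀ x y b, ∑ a, D x y a b = 0) (hB : ∀ x y a, ∑ b, D x y a b = 0) :
    D = ∑ a₁ ∈ Finset.univ.erase a₀, ∑ b₁ ∈ Finset.univ.erase b₀,
      tensorRight (fun a => (if a = a₁ then (1 : ℝ) else 0) - if a = a₀ then 1 else 0)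
        (fun b => (if b = b₁ then (1 : ℝ) else 0) - if b = b₀ then 1 else 0)
        (fun x y => D x y a₁ b₁) := by
  funext x y a b
  simp only [Finset.sum_apply, tensorRight, LinearMap.coe_mk, AddHom.coe_mk]
  rw [← sum_erase_mul_single_sub a₀ a (hA x y b)]
  refine Finset.sum_congr rfl fun a₁ _ => ?_
  rw [← sum_erase_mul_single_sub b₀ b (hB x y a₁), Finset.sum_mul]
  exact Finset.sum_congr rfl fun b₁ _ => by rw [mul_assoc, mul_comm (_ - _) (_ - _)]

end local_models


/-! ### From quantum tables to local models -/

/-- The local cost of tables of inner products of two resolutions of a unit vector. -/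
theorem mem_costBall_of_eq_inner {X Y A B : Type*} [Fintype X] [Fintype Y] [Fintype A] [Fintype B]
    [Nonempty A] [Nonempty B] {K : ℝ} (hK : GrothendieckBound K) {H : Type*}
    [NormedAddCommGroup H] [InnerProductSpace ℝ H] {ψ : H} (hψ : ‖ψ‖ = 1)
    {u : X → A → H} {v : Y → B → H}
    (hu : ∀ x a, inner ℝ (u x a) (u x a) = inner ℝ (u x a) ψ) (hu1 : ∀ x, ∑ a, u x a = ψ)
    (hv : ∀ y b, inner ℝ (v y b) (v y b) = inner ℝ (v y b) ψ) (hv1 : ∀ y, ∑ b, v y b = ψ)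
    {p : Table X Y A B} (hp : ∀ x y a b, p x y a b = inner ℝ (u x a) (v y b)) :
    p ∈ costBall (localSet X Y A B)
      (1 + ((Fintype.card A : ℝ) - 1) * ((Fintype.card B : ℝ) - 1) * K) := by
  classical
  obtain ⟨a₀⟩ := ‹Nonempty A›
  obtain ⟨b₀⟩ := ‹Nonempty B›
  have hK0 : 0 < K := zero_lt_one.trans_le hK.one_le
  have hψ2 : inner ℝ ψ ψ = (1 : ℝ) := by rw [real_inner_self_eq_norm_sq, hψ, one_pow]
  let α : X → A → ℝ := fun x a => inner ℝ (u x a) ψ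
  let β : Y → B → ℝ := fun y b => inner ℝ (v y b) ψ
  have hα : ∀ x, α x ∈ stdSimplex ℝ A := fun x =>
    ⟨fun a => real_inner_self_nonneg.trans_eq (hu x a),
      by simp only [α]; rw [← sum_inner, hu1, hψ2]⟩
  have hβ : ∀ y, β y ∈ stdSimplex ℝ B := fun y =>
    ⟨fun b => real_inner_self_nonneg.trans_eq (hv y b),
      by simp only [β]; rw [← sum_inner, hv1, hψ2]⟩
  let u' : X → A → H := fun x a => u x a - α x a • ψ
  let v' : Y → B → H := fun y b => v y b - β y b • ψ
  -- With `α = ⟨w, ψ⟩ = ‖w‖²`, the squared norm is `4(α - α²) = 1 - (2α - 1)²`.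
  have hhalf : ∀ w : H, inner ℝ w w = inner ℝ w ψ →
      ‖(2 : ℝ) • (w - (inner ℝ w ψ : ℝ) • ψ)‖ ≤ 1 := fun w hw => by
    refine (sq_le_one_iff₀ (norm_nonneg _)).1 ?_
    rw [← real_inner_self_eq_norm_sq]
    simp only [inner_sub_left, inner_sub_right, real_inner_smul_left, real_inner_smul_right, hψ2,
      real_inner_comm w ψ, hw]
    nlinarith [sq_nonneg (2 * (inner ℝ w ψ : ℝ) - 1)]
  let D : Table X Y A B := fun x y a b => inner ℝ (u' x a) (v' y b)
  have hDA : ∀ x y b, ∑ a, D x y a b = 0 := fun x y b => by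
    simp only [D, u']
    rw [← sum_inner, Finset.sum_sub_distrib, hu1, ← Finset.sum_smul, (hα x).2, one_smul, sub_self,
      inner_zero_left]
  have hDB : ∀ x y a, ∑ b, D x y a b = 0 := fun x y a => by
    simp only [D, v']
    rw [← inner_sum, Finset.sum_sub_distrib, hv1, ← Finset.sum_smul, (hβ y).2, one_smul, sub_self,
      inner_zero_right]
  have hpD : p = responseProduct α β + D := by
    funext x y a b
    simp only [hp, D, u', v', responseProduct, LinearMap.mk₂_apply, Pi.add_apply, inner_sub_left,
      inner_sub_right, real_inner_smul_left, real_inner_smul_right, hψ2, α, β]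
    rw [real_inner_comm (v y b) ψ]
    ring
  rw [hpD]
  refine add_mem_costBall (mem_costBall_one (responseProduct_mem_localSet hα hβ)) ?_
  rw [eq_sum_tensorRight a₀ b₀ hDA hDB]
  have hterm : ∀ a₁ b₁, tensorRight
      (fun a => (if a = a₁ then (1 : ℝ) else 0) - if a = a₀ then 1 else 0)
      (fun b => (if b = b₁ then (1 : ℝ) else 0) - if b = b₀ then 1 else 0)
      (fun x y => D x y a₁ b₁) ∈ costBall (localSet X Y A B) K := fun a₁ b₁ => by
    -- Doubling both vectors multiplies the inner product by 4, hence the factor `K / 4`; it cancels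
    -- the cost 4 of a sign matrix.
    have h := smul_mem_costBall (K / 4) (tensorRight_mem_costBall a₁ a₀ b₁ b₀
      (hK.mem_convexHull (fun x => (2 : ℝ) • u' x a₁) (fun y => (2 : ℝ) • v' y b₁)
        (fun x => hhalf _ (hu x a₁)) fun y => hhalf _ (hv y b₁)))
    rw [← map_smul, abs_of_pos (by positivity), div_mul_cancel₀ _ (by norm_num)] at h
    convert h using 2
    funext x y
    simp only [Pi.smul_apply, smul_eq_mul, real_inner_smul_left, real_inner_smul_right, D]
    field_simp
    norm_num
  have h := sum_mem_costBall (Finset.univ.erase a₀) fun a₁ _ =>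
    sum_mem_costBall (Finset.univ.erase b₀) fun b₁ _ => hterm a₁ b₁
  refine costBall_mono (le_of_eq ?_) h
  simp only [Finset.sum_const, Finset.card_erase_of_mem (Finset.mem_univ _), Finset.card_univ,
    nsmul_eq_mul]
  rw [Nat.cast_sub Fintype.card_pos, Nat.cast_sub Fintype.card_pos, Nat.cast_one, mul_assoc]

namespace IsProjectiveMeasurement

variable {C H : Type*} [Fintype C] [NormedAddCommGroup H] [InnerProductSpace ℂ H] [CompleteSpace H]
  {G : C → (H →L[ℂ] H)}

theorem inner_apply_left (hG : IsProjectiveMeasurement G) (c : C) (x y : H) :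
    inner ℂ (G c x) y = inner ℂ x (G c y) :=
  ContinuousLinearMap.isSelfAdjoint_iff_isSymmetric.1 (hG.selfAdjoint c) x y

theorem inner_apply_self (hG : IsProjectiveMeasurement G) (c : C) (ψ : H) :
    inner ℂ (G c ψ) (G c ψ) = inner ℂ (G c ψ) ψ := by
  rw [← hG.inner_apply_left, ← mul_apply_eq_comp, hG.mul_self]

theorem sum_apply_eq (hG : IsProjectiveMeasurement G) (ψ : H) : ∑ c, G c ψ = ψ := by
  rw [← sum_apply, hG.sum_eq_one, one_apply_eq_self]

end IsProjectiveMeasurement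

theorem IsQuantum.mem_costBall {X Y A B : Type*} [Fintype X] [Fintype Y] [Fintype A] [Fintype B]
    [Nonempty A] [Nonempty B] {K : ℝ} (hK : GrothendieckBound K) {p : Table X Y A B}
    (hp : IsQuantum p) : p ∈ costBall (localSet X Y A B)
      (1 + ((Fintype.card A : ℝ) - 1) * ((Fintype.card B : ℝ) - 1) * K) := by
  obtain ⟨H, _, _, _, ψ, E, F, hψ, hE, hF, -, hp⟩ := hp
  -- The probabilities are real, so taking real parts of the inner products loses nothing.
  let _ : InnerProductSpace ℝ H := InnerProductSpace.rclikeToReal ℂ H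
  have hre : ∀ x y : H, inner ℝ x y = (inner ℂ x y : ℂ).re := fun _ _ => rfl
  have hre' : ∀ x y : H, inner ℂ x x = inner ℂ x y → inner ℝ x x = inner ℝ x y :=
    fun x y h => congrArg Complex.re h
  refine mem_costBall_of_eq_inner hK hψ (u := fun x a => E x a ψ) (v := fun y b => F y b ψ)
    (fun x a => hre' _ _ ((hE x).inner_apply_self a ψ)) (fun x => (hE x).sum_apply_eq ψ)
    (fun y b => hre' _ _ ((hF y).inner_apply_self b ψ)) (fun y => (hF y).sum_apply_eq ψ)
    fun x y a b => ?_
  rw [hre, (hE x).inner_apply_left, ← hp, Complex.ofReal_re]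

/-! ### Comparison of the two costs -/

theorem nuTilde_le_mul_gammaTilde {X Y A B : Type*} [Fintype X] [Fintype Y] [Fintype A] [Fintype B]
    [Nonempty A] [Nonempty B] {K : ℝ} (hK : GrothendieckBound K)
    {p : Table X Y A B} (hp : IsNonSignaling p) :
    nuTilde p ≤ (1 + ((Fintype.card A : ℝ) - 1) * ((Fintype.card B : ℝ) - 1) * K)
      * gammaTilde p := by
  have hA : (1 : ℝ) ≤ Fintype.card A := by exact_mod_cast Fintype.card_pos
  have hB : (1 : ℝ) ≤ Fintype.card B := by exact_mod_cast Fintype.card_pos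
  have hC : 0 < 1 + ((Fintype.card A : ℝ) - 1) * ((Fintype.card B : ℝ) - 1) * K := by
    have := mul_nonneg (mul_nonneg (sub_nonneg.2 hA) (sub_nonneg.2 hB))
      (zero_le_one.trans hK.one_le)
    linarith
  rw [← div_le_iff₀' hC]
  refine le_csInf (modelCosts_quantumSet_nonempty hp) fun c hc => ?_
  rw [div_le_iff₀' hC]
  exact sInf_modelCosts_le (costBall_trans (fun q hq => IsQuantum.mem_costBall hK hq) hC.le
    ⟨c, hc, le_rfl⟩)

end Bipartite

theorem mainTheorem4 {X Y A B : Type*} [Fintype X] [Fintype Y] [Fintype A] [Fintype B]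
    (p : Bipartite.Table X Y A B) (hp : Bipartite.IsNonSignaling p) :
    (Fintype.card A = 2 → Fintype.card B = 2 →
      Bipartite.nuTilde p ≤
        (2 * Bipartite.grothendieckConstant + 1) * Bipartite.gammaTilde p) ∧
    Bipartite.nuTilde p ≤
      (2 * (Fintype.card A : ℝ) * (Fintype.card B : ℝ) * (Bipartite.grothendieckConstant + 1) - 1) *
        Bipartite.gammaTilde p := by
  -- Without inputs the outcome sets may be empty, but the only table is zero and both costs vanish.
  by_cases hXY : IsEmpty X ∨ IsEmpty Y
  · have : p = 0 := by
      funext x y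
      exact hXY.elim (fun h => h.elim x) fun h => h.elim y
    simp [this, Bipartite.nuTilde, Bipartite.gammaTilde, Bipartite.sInf_modelCosts_zero]
  simp only [not_or, not_isEmpty_iff] at hXY
  obtain ⟨⟨x⟩, ⟨y⟩⟩ := hXY
  have hAB : ∃ a : A, ∃ b : B, True := by
    by_contra! h
    have h1 := hp.sum_eq_one x y
    have h2 : ∑ a, ∑ b, p x y a b = 0 :=
      Finset.sum_eq_zero fun a _ => Finset.sum_eq_zero fun b _ => (h a b).elim
    linarith
  obtain ⟨a, b, -⟩ := hAB
  have : Nonempty A := ⟨a⟩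
  have : Nonempty B := ⟨b⟩
  have hA : (1 : ℝ) ≤ Fintype.card A := by exact_mod_cast Fintype.card_pos
  have hB : (1 : ℝ) ≤ Fintype.card B := by exact_mod_cast Fintype.card_pos
  have hK := Bipartite.grothendieckBound_grothendieckConstant
  have hK1 := hK.one_le
  have hγ : 0 ≤ Bipartite.gammaTilde p :=
    Real.sInf_nonneg fun _ => Bipartite.modelCosts_nonneg
  have h := Bipartite.nuTilde_le_mul_gammaTilde hK hp
  -- It remains to compare factors: `1 + K ≤ 2K + 1`, and `1 + (A - 1)(B - 1)K ≤ 2AB(K + 1) - 1`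
  -- because `AB ≥ 1`.
  refine ⟨fun hA2 hB2 => h.trans (mul_le_mul_of_nonneg_right ?_ hγ),
    h.trans (mul_le_mul_of_nonneg_right ?_ hγ)⟩
  · rw [hA2, hB2]
    push_cast
    linarith
  · have hAB1 : (1 : ℝ) ≤ Fintype.card A * Fintype.card B := one_le_mul_of_one_le_of_one_le hA hB
    have h1 := mul_le_mul_of_nonneg_right
      (show ((Fintype.card A : ℝ) - 1) * (Fintype.card B - 1) ≤ Fintype.card A * Fintype.card B by
        linarith) (zero_le_one.trans hK1)
    have h2 := mul_nonneg (zero_le_one.trans hAB1) (zero_le_one.trans hK1)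
    linarith
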